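/- Let $A$ be a separable (not necessarily unital) C$^*$-algebra which is primitive, i.e. has a faithful irreducible representation on a Hilbert space. Let $\widehat{A}$ be the set of unitary equivalence classes of (nonzero) irreducible representations of $A$, and let $\widehat{A}^{o}=\{[\pi]\in\widehat{A}\mid \pi \text{ is faithful}\}$. Call a representation of $A$ essential if its range contains no compact operator other than zero. Then the following conditions are equivalent: (i) $|\widehat{A}^{o}|>1$; (ii) every faithful irreducible representation of $A$ is essential; (iii) $A$ has a faithful irreducible representation which is essential; (iv) $\widehat{A}^{o}$ is uncountable. Moreover, if $A$ satisfies any of these conditions, then $A$ is antiliminary, i.e. the only closed two-sided ideal $I$ of $A$ that is liminary (every irreducible representation of $I$ maps $I$ into the compact operators) is $I=\{0\}$. -/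

import Mathlib

universe u

/-- A representation of a (not necessarily unital) C⋆-algebra `A`: a Hilbert space `H` together with
a ⋆-homomorphism of `A` into the bounded operators on `H`. Every irreducible representation
is cyclic, hence its space is, up to unitary equivalence, a completion of a quotient of `A`;
so it is no restriction to let `H` live in the universe of `A`. -/
structure CStarRep (A : Type u) [NonUnitalCStarAlgebra A] : Type (u + 1) where
  /-- The Hilbert space. -/
  H : Type u
  [normedAddCommGroup : NormedAddCommGroup H]
  [innerProductSpace : InnerProductSpace ℂ H]
  [completeSpace : CompleteSpace H]
  /-- The ⋆-homomorphism. -/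
  toHom : A →⋆ₙₐ[ℂ] (H →L[ℂ] H)

attribute [instance] CStarRep.normedAddCommGroup CStarRep.innerProductSpace CStarRep.completeSpace

namespace CStarRep

variable {A : Type u} [NonUnitalCStarAlgebra A]

/-- A representation is (topologically) irreducible if it is nonzero and its only closed invariant
subspaces are `0` and the whole space. -/
def IsIrreducible (π : CStarRep A) : Prop :=
  π.toHom ≠ 0 ∧
    ∀ K : Submodule ℂ π.H, IsClosed (K : Set π.H) → (∀ a : A, ∀ x ∈ K, π.toHom a x ∈ K) →
      K = ⊥ ∨ K = ⊤

/-- A representation is faithful if it is injective. -/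
def IsFaithful (π : CStarRep A) : Prop :=
  Function.Injective π.toHom

/-- A representation is essential if its range contains no nonzero compact operator. -/
def IsEssential (π : CStarRep A) : Prop :=
  ∀ T ∈ Set.range π.toHom, IsCompactOperator T → T = 0

/-- Unitary equivalence of representations. -/
def UnitarilyEquiv (π ρ : CStarRep A) : Prop :=
  ∃ U : π.H ≃ₗᵢ[ℂ] ρ.H, ∀ (a : A) (x : π.H), U (π.toHom a x) = ρ.toHom a (U x)

end CStarRep

section

variable (A : Type u) [NonUnitalCStarAlgebra A]

/-- Unitary equivalence as a setoid on the irreducible representations of `A`. -/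
def irreducibleRepSetoid : Setoid {π : CStarRep A // π.IsIrreducible} where
  r π ρ := π.1.UnitarilyEquiv ρ.1
  iseqv :=
    { refl := fun π => ⟨LinearIsometryEquiv.refl ℂ π.1.H, fun _ _ => rfl⟩
      symm := by
        rintro π ρ ⟨U, hU⟩
        refine ⟨U.symm, fun a x => ?_⟩
        rw [LinearIsometryEquiv.symm_apply_eq, hU, LinearIsometryEquiv.apply_symm_apply]
      trans := by
        rintro π ρ σ ⟨U, hU⟩ ⟨V, hV⟩
        exact ⟨U.trans V, fun a x => by simp [hU, hV]⟩ }

/-- The spectrum (dual) of `A`: the unitary equivalence classes of its irreducible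
representations. -/
def CStarDual : Type (u + 1) :=
  Quotient (irreducibleRepSetoid A)

/-- The set of classes `[π]` in the spectrum of `A` with `π` faithful. -/
def faithfulDual : Set (CStarDual A) :=
  {c | ∃ π : {π : CStarRep A // π.IsIrreducible},
    π.1.IsFaithful ∧ Quotient.mk (irreducibleRepSetoid A) π = c}

/-- A C⋆-algebra is primitive if it has a faithful irreducible representation. -/
def IsPrimitiveCStar : Prop :=
  ∃ π : CStarRep A, π.IsIrreducible ∧ π.IsFaithful

/-- A C⋆-algebra is liminary (CCR) if every irreducible representation maps it into the compact
operators. -/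
def IsLiminary : Prop :=
  ∀ π : CStarRep A, π.IsIrreducible → ∀ a : A, IsCompactOperator (π.toHom a)

/-- A closed two-sided ideal of a C⋆-algebra. -/
structure ClosedTwoSidedIdeal extends Submodule ℂ A where
  isClosed_carrier : IsClosed carrier
  mul_mem_left : ∀ (a : A) {x : A}, x ∈ carrier → a * x ∈ carrier
  mul_mem_right : ∀ {x : A} (a : A), x ∈ carrier → x * a ∈ carrier

end

namespace ClosedTwoSidedIdeal

variable {A : Type u} [NonUnitalCStarAlgebra A]

/-- The selfadjoint part `I ∩ I⋆` of a closed two-sided ideal `I`, as a ⋆-subalgebra. -/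
def interStar (I : ClosedTwoSidedIdeal A) : NonUnitalStarSubalgebra ℂ A where
  carrier := {x | x ∈ I.carrier ∧ star x ∈ I.carrier}
  add_mem' := fun ⟨hx, hx'⟩ ⟨hy, hy'⟩ =>
    ⟨I.add_mem' hx hy, by rw [star_add]; exact I.add_mem' hx' hy'⟩
  zero_mem' := ⟨I.zero_mem', by rw [star_zero]; exact I.zero_mem'⟩
  mul_mem' := fun {x y} ⟨_, hx'⟩ ⟨hy, _⟩ =>
    ⟨I.mul_mem_left x hy, by rw [star_mul]; exact I.mul_mem_left _ hx'⟩
  smul_mem' := fun c _ ⟨hx, hx'⟩ =>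
    ⟨I.smul_mem' c hx, by rw [star_smul]; exact I.smul_mem' _ hx'⟩
  star_mem' := fun {x} ⟨hx, hx'⟩ => ⟨hx', by rw [star_star]; exact hx⟩

theorem isClosed_interStar (I : ClosedTwoSidedIdeal A) : IsClosed (I.interStar : Set A) :=
  I.isClosed_carrier.inter (I.isClosed_carrier.preimage continuous_star)

/-- A closed two-sided ideal of a C⋆-algebra is selfadjoint. -/
theorem star_mem (I : ClosedTwoSidedIdeal A) {x : A} (hx : x ∈ I.carrier) :
    star x ∈ I.carrier := by
  have : IsClosed (I.interStar : Set A) := I.isClosed_interStar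
  letI : PartialOrder I.interStar := CStarAlgebra.spectralOrder _
  have : StarOrderedRing I.interStar := CStarAlgebra.spectralOrderedRing _
  have hl := CStarAlgebra.increasingApproximateUnit I.interStar
  set l := CStarAlgebra.approximateUnit I.interStar
  have hb : x * star x ∈ I.interStar :=
    ⟨I.mul_mem_right _ hx, by rw [star_mul, star_star]; exact I.mul_mem_right _ hx⟩
  have h1 : Filter.Tendsto (fun e : I.interStar => x * star x * (e : A)) l
      (nhds (x * star x)) :=
    (continuous_subtype_val.tendsto _).comp (hl.tendsto_mul_left ⟨_, hb⟩)
  have h2 : Filter.Tendsto (fun e : I.interStar => 2 * ‖x * star x - x * star x * (e : A)‖) l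
      (nhds 0) := by
    simpa using ((tendsto_const_nhds (x := x * star x)).sub h1).norm.const_mul 2
  have h3 : Filter.Tendsto (fun e : I.interStar => ‖star x * (e : A) - star x‖ ^ 2) l
      (nhds 0) := by
    refine tendsto_of_tendsto_of_tendsto_of_le_of_le' tendsto_const_nhds h2
      (Filter.Eventually.of_forall fun e => by positivity) ?_
    filter_upwards [hl.eventually_norm, hl.eventually_star_eq] with e he he'
    have hs : star (e : A) = e := congrArg Subtype.val he'
    have hn : ‖(e : A)‖ ≤ 1 := he
    have key : star (star x * (e : A) - star x) * (star x * (e : A) - star x) =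
        (x * star x - x * star x * e) - e * (x * star x - x * star x * e) := by
      simp only [star_sub, star_mul, star_star, hs, mul_sub, sub_mul, mul_assoc]
      abel
    rw [sq, ← CStarRing.norm_star_mul_self, key]
    calc _ ≤ ‖x * star x - x * star x * (e : A)‖ +
            ‖(e : A) * (x * star x - x * star x * (e : A))‖ := norm_sub_le _ _
      _ ≤ ‖x * star x - x * star x * (e : A)‖ +
            1 * ‖x * star x - x * star x * (e : A)‖ := by
          gcongr
          exact (norm_mul_le _ _).trans (by gcongr)
      _ = _ := by ring
  have h4 : Filter.Tendsto (fun e : I.interStar => star x * (e : A)) l (nhds (star x)) := by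
    rw [tendsto_iff_norm_sub_tendsto_zero]
    simpa using h3.sqrt
  exact I.isClosed_carrier.mem_of_tendsto h4
    (Filter.Eventually.of_forall fun e => I.mul_mem_left _ e.2.1)

/-- A closed two-sided ideal of a C⋆-algebra as a ⋆-subalgebra. -/
def toStarSubalgebra (I : ClosedTwoSidedIdeal A) : NonUnitalStarSubalgebra ℂ A where
  carrier := I.carrier
  add_mem' := I.add_mem'
  zero_mem' := I.zero_mem'
  mul_mem' := fun {x _} _ hy => I.mul_mem_left x hy
  smul_mem' := I.smul_mem'
  star_mem' := fun hx => I.star_mem hx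

/-- Closedness of the ⋆-subalgebra `I`; it makes `I` a C⋆-algebra in its own right. -/
instance isClosed_toStarSubalgebra (I : ClosedTwoSidedIdeal A) :
    IsClosed (I.toStarSubalgebra : Set A) :=
  I.isClosed_carrier

end ClosedTwoSidedIdeal

/-- A C⋆-algebra is antiliminary if its only liminary closed two-sided ideal is `0`. -/
def IsAntiliminary (A : Type u) [NonUnitalCStarAlgebra A] : Prop :=
  ∀ I : ClosedTwoSidedIdeal A, IsLiminary I.toStarSubalgebra → I.toSubmodule = ⊥

/-! Everything turns on a dichotomy: either `A` has a minimal projection, or every nonzero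
selfadjoint `x` has two orthogonal nonzero selfadjoint elements in `xAx`.

A minimal projection `p` makes all faithful irreducible representations equivalent: if `p` fixes a
unit vector, the vector functional there is determined by `pAp = ℂp`. It also acts with rank at most
one in any irreducible representation. Conversely, a nonzero compact operator in the range of a
faithful representation yields a minimal projection, by descent on rank. So two inequivalent
faithful irreducible representations force essentiality, and an essential one excludes minimal
projections.

Without minimal projections one diagonalises against any sequence `σ n` of irreducible
representations (`exists_faithful_not_unitarilyEquiv`). Separability reduces faithfulness and
inequivalence to countably many requirements, met in turn along decreasing local units `e n`. The
states on which all `e n` act as units form a nonempty weak-⋆ compact set. An extreme point gives an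
irreducible representation with a common fixed vector, and that vector witnesses every requirement.
Hence the faithful classes are uncountable.

A liminary ideal acts by compact operators in an essential faithful irreducible representation,
hence is zero. -/

/-! ### Functional calculus: local units, splitting and minimal projections. -/

section CStarAlgebra

variable {A : Type*} [NonUnitalCStarAlgebra A]

/-- A continuous function vanishing near `0` factors, in the functional calculus of `x`, through
left and right multiplication by `x`. -/
theorem exists_cfcₙ_eq_mul_mul {x : A} (hx : IsSelfAdjoint x) {k : ℝ → ℝ} (hk : Continuous k)
    {δ : ℝ} (hδ : 0 < δ) (hk0 : ∀ t, |t| ≤ δ → k t = 0) : ∃ d : A, cfcₙ k x = x * d * x := by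
  -- Truncating the denominator keeps `k t / t ^ 2` continuous at `0` and changes nothing where `k`
  -- is nonzero.
  have hpos : ∀ t : ℝ, max (t ^ 2) (δ ^ 2) ≠ 0 := fun t => by positivity
  have hz : k 0 = 0 := hk0 0 (by simpa using hδ.le)
  have hc : Continuous fun t => k t / max (t ^ 2) (δ ^ 2) :=
    hk.div (by fun_prop) hpos
  refine ⟨cfcₙ (fun t => k t / max (t ^ 2) (δ ^ 2)) x, ?_⟩
  have h1 : x * cfcₙ (fun t => k t / max (t ^ 2) (δ ^ 2)) x * x =
      cfcₙ (fun t => t * (k t / max (t ^ 2) (δ ^ 2)) * t) x := by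
    rw [cfcₙ_mul (fun t => t * (k t / max (t ^ 2) (δ ^ 2))) (fun t => t) x
      (by fun_prop) (by simp) (by fun_prop) rfl,
      cfcₙ_mul (fun t => t) (fun t => k t / max (t ^ 2) (δ ^ 2)) x
      (by fun_prop) rfl hc.continuousOn (by simp [hz]), cfcₙ_id' ℝ x]
  rw [h1]
  congr 1
  funext t
  rcases le_or_gt |t| δ with h | h
  · simp [hk0 t h]
  · have h2 : δ ^ 2 ≤ t ^ 2 := by rw [← sq_abs t]; gcongr
    have h3 : t ≠ 0 := by rintro rfl; simp at h; linarith
    rw [max_eq_left h2]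
    field_simp

theorem cfcₙ_ne_zero_of_mem_quasispectrum {x : A} (hx : IsSelfAdjoint x) {k : ℝ → ℝ}
    (hk : Continuous k) (hk0 : k 0 = 0) {t : ℝ} (ht : t ∈ quasispectrum ℝ x) (hkt : k t ≠ 0) :
    cfcₙ k x ≠ 0 := by
  intro h
  have h1 := cfcₙ_map_quasispectrum k x hk.continuousOn hk0 hx
  rw [h, CFC.quasispectrum_zero_eq] at h1
  have h2 : k t ∈ ({0} : Set ℝ) := h1 ▸ ⟨t, ht, rfl⟩
  exact hkt h2

/-- Every nonzero selfadjoint `x` dominates a nonzero selfadjoint element with a local unit. -/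
theorem IsSelfAdjoint.exists_local_unit {x : A} (hx : IsSelfAdjoint x) (h0 : x ≠ 0) :
    ∃ e b d g : A, IsSelfAdjoint e ∧ IsSelfAdjoint b ∧ b ≠ 0 ∧ e * b = b ∧
      e = x * d ∧ b = x * g := by
  have hr : 0 < ‖x‖ := norm_pos_iff.mpr h0
  set r := ‖x‖
  obtain ⟨⟨t, ht, hxt⟩, -⟩ :=
    NonUnitalIsometricContinuousFunctionalCalculus.isGreatest_norm_quasispectrum (𝕜 := ℝ) x hx
  have hxt : |t| = r := hxt
  -- Both vanish for `|t| ≤ r / 3`. As `g` lives on `|t| > 2 * r / 3`, where `f = 1`, we get `f * g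
  -- = g`; and `g = 1` at the spectral point of modulus `r`.
  let f : ℝ → ℝ := fun t => min 1 (max 0 (3 * |t| / r - 1))
  let g : ℝ → ℝ := fun t => max 0 (3 * |t| / r - 2)
  have hfc : Continuous f := by fun_prop
  have hgc : Continuous g := by fun_prop
  have hf0 : ∀ t, |t| ≤ r / 3 → f t = 0 := by
    intro t ht
    have : 3 * |t| / r ≤ 1 := by rw [div_le_one hr]; linarith
    simp only [f]
    rw [max_eq_left (by linarith)]
    simp
  have hg0 : ∀ t, |t| ≤ r / 3 → g t = 0 := by
    intro t ht
    have : 3 * |t| / r ≤ 1 := by rw [div_le_one hr]; linarith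
    exact max_eq_left (by linarith)
  obtain ⟨d, hd⟩ := exists_cfcₙ_eq_mul_mul hx hfc (by positivity) hf0
  obtain ⟨d', hd'⟩ := exists_cfcₙ_eq_mul_mul hx hgc (by positivity) hg0
  have hz : |(0 : ℝ)| ≤ r / 3 := by rw [abs_zero]; positivity
  refine ⟨cfcₙ f x, cfcₙ g x, d * x, d' * x, cfcₙ_predicate f x, cfcₙ_predicate g x,
    cfcₙ_ne_zero_of_mem_quasispectrum hx hgc (hg0 0 hz) ht ?_, ?_, by rw [hd, mul_assoc],
    by rw [hd', mul_assoc]⟩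
  · simp only [g, hxt, mul_div_assoc, div_self hr.ne']
    norm_num
  · rw [← cfcₙ_mul f g x hfc.continuousOn (hf0 0 hz) hgc.continuousOn (hg0 0 hz)]
    congr 1
    funext s
    rcases le_or_gt (3 * |s| / r) 2 with h | h
    · have : g s = 0 := max_eq_left (by linarith)
      simp [this]
    · have : f s = 1 := min_eq_left (le_max_of_le_right (by linarith))
      simp [this]

/-- Two orthogonal nonzero selfadjoint elements in `xAx`. -/
def SplitsBelow (x : A) : Prop :=
  ∃ c₁ c₂ d₁ d₂ : A, IsSelfAdjoint c₁ ∧ IsSelfAdjoint c₂ ∧ c₁ ≠ 0 ∧ c₂ ≠ 0 ∧ c₁ * c₂ = 0 ∧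
    c₁ = x * d₁ * x ∧ c₂ = x * d₂ * x

/-- A nonzero projection `p` with `pAp = ℂp`. -/
def IsMinimalProjection (p : A) : Prop :=
  IsSelfAdjoint p ∧ p * p = p ∧ p ≠ 0 ∧ ∀ a, ∃ l : ℂ, p * a * p = l • p

/-- Two distinct nonzero spectral values carry disjoint bump functions supported away from `0`.
Otherwise the quasispectrum has just one nonzero point `t`, and `x` is `t` times a projection. -/
theorem IsSelfAdjoint.splitsBelow_or_mul_self_eq_smul {x : A} (hx : IsSelfAdjoint x) (h0 : x ≠ 0) :
    SplitsBelow x ∨ ∃ t : ℝ, t ≠ 0 ∧ x * x = t • x := by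
  by_cases h : ∃ s ∈ quasispectrum ℝ x, ∃ t ∈ quasispectrum ℝ x, s ≠ 0 ∧ t ≠ 0 ∧ s ≠ t
  · left
    obtain ⟨s, hs, t, ht, hs0, ht0, hst⟩ := h
    have hs' := abs_pos.mpr hs0
    have ht' := abs_pos.mpr ht0
    have hst' := abs_pos.mpr (sub_ne_zero.mpr hst)
    obtain ⟨δ, hδ, h1, h2, h3⟩ : ∃ δ : ℝ, 0 < δ ∧ 2 * δ ≤ |s| ∧ 2 * δ ≤ |t| ∧ 2 * δ ≤ |s - t| :=
      ⟨min (min |s| |t|) |s - t| / 2, by positivity,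
        by linarith [min_le_left (min |s| |t|) |s - t|, min_le_left |s| |t|],
        by linarith [min_le_left (min |s| |t|) |s - t|, min_le_right |s| |t|],
        by linarith [min_le_right (min |s| |t|) |s - t|]⟩
    have key : ∀ w ∈ quasispectrum ℝ x, 2 * δ ≤ |w| →
        ∃ d, cfcₙ (fun u => max 0 (δ - |u - w|)) x = x * d * x ∧
          cfcₙ (fun u => max 0 (δ - |u - w|)) x ≠ 0 := by
      intro w hw h
      have hc : Continuous (fun u => max 0 (δ - |u - w|)) := by fun_prop
      have hv : ∀ u, |u| ≤ δ → max 0 (δ - |u - w|) = 0 := by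
        intro u hu
        refine max_eq_left ?_
        have := abs_sub_abs_le_abs_sub w u
        rw [abs_sub_comm w u] at this
        linarith
      obtain ⟨d, hd⟩ := exists_cfcₙ_eq_mul_mul hx hc hδ hv
      refine ⟨d, hd, cfcₙ_ne_zero_of_mem_quasispectrum hx hc (hv 0 (by simpa using hδ.le)) hw ?_⟩
      simp [hδ.le, hδ.ne']
    obtain ⟨d₁, hd₁, hn₁⟩ := key s hs h1
    obtain ⟨d₂, hd₂, hn₂⟩ := key t ht h2
    refine ⟨_, _, d₁, d₂, cfcₙ_predicate _ x, cfcₙ_predicate _ x, hn₁, hn₂, ?_, hd₁, hd₂⟩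
    rw [← cfcₙ_mul _ _ x (by fun_prop) (by simp; linarith) (by fun_prop) (by simp; linarith)]
    rw [← cfcₙ_const_zero ℝ x]
    congr 1
    funext u
    rcases le_or_gt δ |u - s| with h | h
    · rw [max_eq_left (by linarith), zero_mul]
    · have := abs_sub_le s u t
      rw [abs_sub_comm s u] at this
      rw [max_eq_left (a := 0) (b := δ - |u - t|) (by linarith), mul_zero]
  · right
    push Not at h
    obtain ⟨t, ht, ht0⟩ : ∃ t ∈ quasispectrum ℝ x, t ≠ 0 := by
      by_contra! hc
      exact h0 (CFC.eq_zero_of_quasispectrum_eq_zero (R := ℝ) x hc hx)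
    refine ⟨t, ht0, ?_⟩
    conv_lhs => rw [← cfcₙ_id' ℝ x]
    rw [← cfcₙ_mul (fun u => u) (fun u => u) x, ← cfcₙ_const_mul_id t x]
    refine cfcₙ_congr fun u hu => ?_
    by_cases hu0 : u = 0
    · simp [hu0]
    · simp [h u hu t ht hu0 ht0]

/-- Either nonzero selfadjoint elements always split, or there is a minimal projection. -/
theorem IsSelfAdjoint.splitsBelow_or_exists_isMinimalProjection {x : A} (hx : IsSelfAdjoint x)
    (h0 : x ≠ 0) : SplitsBelow x ∨ ∃ p : A, IsMinimalProjection p := by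
  rcases hx.splitsBelow_or_mul_self_eq_smul h0 with h | ⟨t, ht, hxt⟩
  · exact Or.inl h
  by_cases hmin : ∀ a, IsSelfAdjoint a → ∃ l : ℂ, x * a * x = l • x
  · right
    refine ⟨t⁻¹ • x, IsSelfAdjoint.smul (IsSelfAdjoint.all _) hx, ?_, smul_ne_zero (inv_ne_zero ht) h0,
      fun a => ?_⟩
    · rw [smul_mul_smul_comm, hxt, smul_smul]
      congr 1
      field_simp
    · obtain ⟨l, hl⟩ := hmin _ (realPart a).2
      obtain ⟨m, hm⟩ := hmin _ (_root_.imaginaryPart a).2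
      refine ⟨(t⁻¹ : ℝ) • (l + Complex.I * m), ?_⟩
      have : x * a * x = (l + Complex.I * m) • x := by
        conv_lhs => rw [← realPart_add_I_smul_imaginaryPart a]
        rw [mul_add, add_mul, mul_smul_comm, smul_mul_assoc, hl, hm, smul_smul, add_smul]
      rw [smul_mul_assoc, smul_mul_smul_comm, this, mul_smul, smul_assoc,
        smul_comm (l + Complex.I * m) t⁻¹ x]
  · left
    push Not at hmin
    obtain ⟨a, ha, hax⟩ := hmin
    have hy : IsSelfAdjoint (x * a * x) := by
      rw [IsSelfAdjoint, star_mul, star_mul, hx.star_eq, ha.star_eq, mul_assoc]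
    have hy0 : x * a * x ≠ 0 := fun h => hax 0 (by simpa using h)
    rcases hy.splitsBelow_or_mul_self_eq_smul hy0 with h | ⟨s, hs, hys⟩
    · obtain ⟨c₁, c₂, d₁, d₂, h1, h2, h3, h4, h5, h6, h7⟩ := h
      exact ⟨c₁, c₂, a * x * d₁ * x * a, a * x * d₂ * x * a, h1, h2, h3, h4, h5,
        by rw [h6]; simp only [mul_assoc], by rw [h7]; simp only [mul_assoc]⟩
    · set y := x * a * x
      have hxy : x * y = t • y := by
        simp only [y, ← mul_assoc, hxt, smul_mul_assoc]
      have hyx : y * x = t • y := by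
        simp only [y, mul_assoc, hxt, mul_smul_comm]
      -- Here `t⁻¹ • x` and `s⁻¹ • y` are projections, the second below the first, so their
      -- difference is orthogonal to `y`. The factor `t⁻³` compensates `x * x * x = t² • x`.
      refine ⟨y, t⁻¹ • x - s⁻¹ • y, a, t⁻¹ • t⁻¹ • t⁻¹ • x - s⁻¹ • a, hy,
        (IsSelfAdjoint.smul (IsSelfAdjoint.all _) hx).sub (IsSelfAdjoint.smul (IsSelfAdjoint.all _) hy), hy0, ?_, ?_, rfl, ?_⟩
      · intro h
        refine hax ((s * t⁻¹ : ℝ) : ℂ) ?_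
        rw [sub_eq_zero] at h
        rw [Complex.coe_smul, mul_smul, h, smul_smul, mul_inv_cancel₀ hs, one_smul]
      · rw [mul_sub, mul_smul_comm, mul_smul_comm, hyx, hys, smul_smul, smul_smul,
          inv_mul_cancel₀ hs, inv_mul_cancel₀ ht, sub_self]
      · rw [mul_sub, sub_mul, mul_smul_comm, mul_smul_comm, mul_smul_comm, mul_smul_comm,
          smul_mul_assoc, smul_mul_assoc, smul_mul_assoc, smul_mul_assoc, hxt, smul_mul_assoc, hxt]
        congr 1
        simp only [smul_smul]
        congr 1
        field_simp

end CStarAlgebra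

/-! ### Irreducible representations, compact operators and minimal projections. -/

namespace CStarRep

variable {A : Type u} [NonUnitalCStarAlgebra A] {π ρ : CStarRep A}

theorem toHom_mul_apply (π : CStarRep A) (a b : A) (x : π.H) :
    π.toHom (a * b) x = π.toHom a (π.toHom b x) := by
  rw [map_mul]; rfl

theorem inner_toHom_left (π : CStarRep A) (a : A) (x y : π.H) :
    inner ℂ (π.toHom a x) y = inner ℂ x (π.toHom (star a) y) := by
  rw [map_star, ContinuousLinearMap.star_eq_adjoint, ContinuousLinearMap.adjoint_inner_right]

theorem inner_toHom_right (π : CStarRep A) (a : A) (x y : π.H) :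
    inner ℂ x (π.toHom a y) = inner ℂ (π.toHom (star a) x) y := by
  rw [inner_toHom_left, star_star]

/-- The orbit map `a ↦ π(a)x`. -/
noncomputable def orbit (π : CStarRep A) (x : π.H) : A →ₗ[ℂ] π.H where
  toFun a := π.toHom a x
  map_add' a b := by simp
  map_smul' c a := by simp

@[simp]
theorem orbit_apply (π : CStarRep A) (x : π.H) (a : A) : π.orbit x a = π.toHom a x := rfl

theorem norm_toHom_le (π : CStarRep A) (a : A) : ‖π.toHom a‖ ≤ ‖a‖ :=
  NonUnitalStarAlgHom.norm_apply_le π.toHom a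

theorem continuous_orbit (π : CStarRep A) (x : π.H) : Continuous (π.orbit x) :=
  AddMonoidHomClass.continuous_of_bound (π.orbit x) ‖x‖ fun a =>
    ((π.toHom a).le_opNorm x).trans <| by
      rw [mul_comm]
      gcongr
      exact π.norm_toHom_le a

/-- The orbit closure is invariant, but without a unit it might be zero. In that case `x` lies in
the common kernel of all `π.toHom a`, itself closed and invariant: it is not `⊥` since `x ≠ 0`, and
not `⊤` since `π` is nonzero. -/
theorem IsIrreducible.denseRange_orbit (h : π.IsIrreducible) {x : π.H} (hx : x ≠ 0) :
    DenseRange (π.orbit x) := by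
  have hinv : ∀ a, ∀ y ∈ (LinearMap.range (π.orbit x)).topologicalClosure,
      π.toHom a y ∈ (LinearMap.range (π.orbit x)).topologicalClosure := by
    intro a y hy
    refine map_mem_closure (π.toHom a).continuous hy ?_
    rintro _ ⟨b, rfl⟩
    exact ⟨a * b, π.toHom_mul_apply a b x⟩
  rcases h.2 _ (Submodule.isClosed_topologicalClosure _) hinv with hK | hK
  · exfalso
    have hx0 : ∀ a, π.toHom a x = 0 := fun a => by
      have : π.toHom a x ∈ (LinearMap.range (π.orbit x)).topologicalClosure :=
        Submodule.le_topologicalClosure _ ⟨a, rfl⟩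
      rwa [hK, Submodule.mem_bot] at this
    let N : Submodule ℂ π.H := ⨅ a, LinearMap.ker (π.toHom a).toLinearMap
    have hN : ∀ y, y ∈ N ↔ ∀ a, π.toHom a y = 0 := fun y => by
      simp [N, Submodule.mem_iInf]
    have hNc : IsClosed (N : Set π.H) := by
      have : (N : Set π.H) = ⋂ a, {y | π.toHom a y = 0} := by
        ext y
        simp [hN]
      rw [this]
      exact isClosed_iInter fun a => isClosed_eq (π.toHom a).continuous continuous_const
    rcases h.2 N hNc fun a y hy => (hN _).2 fun b => by
      rw [← toHom_mul_apply]; exact (hN y).1 hy _ with hN' | hN'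
    · exact hx (by simpa [hN'] using (hN x).2 hx0)
    · exact h.1 (NonUnitalStarAlgHom.ext fun a => ContinuousLinearMap.ext fun y =>
        (hN y).1 (hN' ▸ Submodule.mem_top) a)
  · rw [← Submodule.dense_iff_topologicalClosure_eq_top] at hK
    exact hK

theorem exists_toHom_apply_ne_zero {a : A} (h : π.toHom a ≠ 0) : ∃ x, π.toHom a x ≠ 0 := by
  by_contra! hc
  exact h (ContinuousLinearMap.ext hc)

theorem IsFaithful.toHom_ne_zero (h : π.IsFaithful) {a : A} (ha : a ≠ 0) : π.toHom a ≠ 0 :=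
  fun h0 => ha (h (h0.trans (map_zero _).symm))

/-- An irreducible representation maps minimal projections to operators of rank at most one. -/
theorem IsIrreducible.isCompactOperator_of_isMinimalProjection (h : π.IsIrreducible) {p : A}
    (hp : IsMinimalProjection p) : IsCompactOperator (π.toHom p) := by
  obtain ⟨-, hpp, -, hpa⟩ := hp
  by_cases h0 : π.toHom p = 0
  · rw [h0]
    exact isCompactOperator_zero
  obtain ⟨u, hu⟩ := exists_toHom_apply_ne_zero h0
  set x := π.toHom p u with hx
  have hpx : π.toHom p x = x := by rw [hx, ← toHom_mul_apply, hpp]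
  have hmem : ∀ y, π.toHom p y ∈ (ℂ ∙ x) := by
    have hcl : IsClosed {y | π.toHom p y ∈ (ℂ ∙ x)} :=
      (Submodule.closed_of_finiteDimensional (ℂ ∙ x)).preimage (π.toHom p).continuous
    refine fun y => (h.denseRange_orbit hu).induction_on y hcl fun a => ?_
    obtain ⟨l, hl⟩ := hpa a
    change π.toHom p (π.toHom a x) ∈ (ℂ ∙ x)
    rw [show π.toHom p (π.toHom a x) = π.toHom p (π.toHom a (π.toHom p x)) by rw [hpx],
      ← toHom_mul_apply, ← toHom_mul_apply, hl,
      map_smul, smul_apply, hpx]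
    exact Submodule.smul_mem _ _ (Submodule.mem_span_singleton_self x)
  have : LocallyCompactSpace (ℂ ∙ x) :=
    have := FiniteDimensional.proper ℂ (ℂ ∙ x)
    inferInstance
  have hrng : IsCompactOperator ((π.toHom p).codRestrict (ℂ ∙ x) hmem) :=
    (isCompactOperator_id (E := (ℂ ∙ x))).comp_clm ((π.toHom p).codRestrict (ℂ ∙ x) hmem)
  exact hrng.clm_comp (ℂ ∙ x).subtypeL

theorem IsEssential.not_isMinimalProjection (he : π.IsEssential) (hi : π.IsIrreducible)
    (hf : π.IsFaithful) (p : A) : ¬ IsMinimalProjection p := fun hp =>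
  hf.toHom_ne_zero hp.2.2.1 (he _ ⟨p, rfl⟩ (hi.isCompactOperator_of_isMinimalProjection hp))

/-- A local unit `e` in the ideal generated by `a` acts compactly, so its eigenspace for `1` is
finite-dimensional and contains the range of every `b` with `e * b = b`. If no minimal projection
existed, such `b` could be split forever with strictly falling rank. -/
theorem exists_isMinimalProjection_of_isCompactOperator (hf : π.IsFaithful) {a : A} (ha : a ≠ 0)
    (hc : IsCompactOperator (π.toHom a)) : ∃ p : A, IsMinimalProjection p := by
  by_contra! hno
  obtain ⟨e, b, d, g, he, hb, hb0, heb, hed, -⟩ :=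
    (IsSelfAdjoint.star_mul_self a).exists_local_unit (CStarRing.star_mul_self_ne_zero_iff a |>.2 ha)
  have hec : IsCompactOperator (π.toHom e) := by
    have h1 : IsCompactOperator (π.toHom (star a) ∘ (π.toHom a ∘ π.toHom d)) :=
      (hc.comp_clm (π.toHom d)).clm_comp (π.toHom (star a))
    convert h1
    ext x
    simp [hed]
  have hfin := ContinuousLinearMap.finite_dimensional_eigenspace hec 1 one_ne_zero
  have hle : ∀ b : A, e * b = b → LinearMap.range (π.toHom b).toLinearMap ≤
      Module.End.eigenspace (π.toHom e).toLinearMap 1 := by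
    rintro b hb _ ⟨y, rfl⟩
    rw [Module.End.mem_eigenspace_iff, one_smul]
    change π.toHom e (π.toHom b y) = π.toHom b y
    rw [← toHom_mul_apply, hb]
  have key : ∀ n : ℕ, ∀ b : A, IsSelfAdjoint b → b ≠ 0 → e * b = b →
      Module.finrank ℂ (LinearMap.range (π.toHom b).toLinearMap) = n → False := by
    intro n
    induction n using Nat.strong_induction_on with
    | _ n ih =>
      intro b hb hb0 heb hn
      obtain ⟨c₁, c₂, d₁, d₂, h1, h2, h3, h4, h5, h6, h7⟩ :=
        (hb.splitsBelow_or_exists_isMinimalProjection hb0).resolve_right (by simpa using hno)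
      have hcb : LinearMap.range (π.toHom c₁).toLinearMap ≤
          LinearMap.range (π.toHom b).toLinearMap := by
        rintro _ ⟨y, rfl⟩
        refine ⟨π.toHom (d₁ * b) y, ?_⟩
        change π.toHom b (π.toHom (d₁ * b) y) = π.toHom c₁ y
        rw [← toHom_mul_apply, h6, mul_assoc]
      have := Submodule.finiteDimensional_of_le (hle b heb)
      -- The range of `c₂` is nonzero, lies in that of `b`, and is orthogonal to that of `c₁`.
      have hlt : LinearMap.range (π.toHom c₁).toLinearMap <
          LinearMap.range (π.toHom b).toLinearMap := by
        refine lt_of_le_of_ne hcb fun heq => ?_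
        obtain ⟨y, hy⟩ := exists_toHom_apply_ne_zero (hf.toHom_ne_zero h4)
        have hm : π.toHom c₂ y ∈ LinearMap.range (π.toHom c₁).toLinearMap := by
          rw [heq]
          refine ⟨π.toHom (d₂ * b) y, ?_⟩
          change π.toHom b (π.toHom (d₂ * b) y) = π.toHom c₂ y
          rw [← toHom_mul_apply, h7, mul_assoc]
        obtain ⟨z, hz⟩ := hm
        change π.toHom c₁ z = π.toHom c₂ y at hz
        refine hy (inner_self_eq_zero (𝕜 := ℂ) |>.1 ?_)
        nth_rw 1 [← hz]
        rw [inner_toHom_left, h1.star_eq, ← toHom_mul_apply, h5]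
        simp
      refine ih _ (hn ▸ Submodule.finrank_lt_finrank_of_lt hlt) c₁ h1 h3 ?_ rfl
      rw [h6, ← mul_assoc, ← mul_assoc, heb]
  exact key _ b hb hb0 heb rfl

theorem IsMinimalProjection.exists_unit (hf : π.IsFaithful) {p : A} (hp : IsMinimalProjection p) :
    ∃ x : π.H, ‖x‖ = 1 ∧ π.toHom p x = x := by
  obtain ⟨y, hy⟩ := exists_toHom_apply_ne_zero (hf.toHom_ne_zero hp.2.2.1)
  refine ⟨(‖π.toHom p y‖⁻¹ : ℂ) • π.toHom p y, norm_smul_inv_norm hy, ?_⟩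
  rw [map_smul, ← toHom_mul_apply, hp.2.1]

/-- Equality of norms makes `π(a)x ↦ ρ(a)y` a well-defined isometry between dense orbits; its
extension intertwines. -/
theorem unitarilyEquiv_of_norm_eq (hπ : π.IsIrreducible) (hρ : ρ.IsIrreducible) {x : π.H} {y : ρ.H}
    (hx : x ≠ 0) (hy : y ≠ 0) (h : ∀ a, ‖π.toHom a x‖ = ‖ρ.toHom a y‖) : π.UnitarilyEquiv ρ := by
  have d₁ := hπ.denseRange_orbit hx
  have d₂ := hρ.denseRange_orbit hy
  have n₁ : ∃ C, ∀ a, ‖ρ.orbit y (LinearEquiv.refl ℂ A a)‖ ≤ C * ‖π.orbit x a‖ :=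
    ⟨1, fun a => by simp [h a]⟩
  have n₂ : ∃ C, ∀ a, ‖π.orbit x ((LinearEquiv.refl ℂ A).symm a)‖ ≤ C * ‖ρ.orbit y a‖ :=
    ⟨1, fun a => by simp [h a]⟩
  let V := (LinearEquiv.refl ℂ A).extend (π.orbit x) (ρ.orbit y) d₁ n₁ d₂ n₂
  have hV : ∀ a, V (π.toHom a x) = ρ.toHom a y := fun a =>
    LinearEquiv.extend_eq (LinearEquiv.refl ℂ A) (π.orbit x) (ρ.orbit y) d₁ n₁ d₂ n₂ a
  refine ⟨⟨V.toLinearEquiv, fun z => ?_⟩, fun a z => ?_⟩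
  · refine d₁.induction_on z (isClosed_eq V.continuous.norm continuous_norm) fun a => ?_
    exact (congrArg norm (hV a)).trans (h a).symm
  · change V (π.toHom a z) = ρ.toHom a (V z)
    refine d₁.induction_on z (isClosed_eq (by fun_prop) (by fun_prop)) fun b => ?_
    rw [orbit_apply, ← toHom_mul_apply, hV, hV, toHom_mul_apply]

/-- On a unit vector fixed by `p`, `‖π(a)x‖²` is the scalar `l` with `p(a⋆a)p = l p`, which does not
depend on the representation. -/
theorem unitarilyEquiv_of_isMinimalProjection {p : A} (hp : IsMinimalProjection p)
    (hπ : π.IsIrreducible) (hπf : π.IsFaithful) (hρ : ρ.IsIrreducible) (hρf : ρ.IsFaithful) :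
    π.UnitarilyEquiv ρ := by
  obtain ⟨x, hx1, hx⟩ := IsMinimalProjection.exists_unit hπf hp
  obtain ⟨y, hy1, hy⟩ := IsMinimalProjection.exists_unit hρf hp
  have key : ∀ (σ : CStarRep A) (z : σ.H), ‖z‖ = 1 → σ.toHom p z = z → ∀ (a : A) (l : ℂ),
      p * (star a * a) * p = l • p → ((‖σ.toHom a z‖ : ℂ)) ^ 2 = l := by
    intro σ z hz1 hz a l hl
    have h1 := inner_self_eq_norm_sq_to_K (𝕜 := ℂ) (σ.toHom a z)
    rw [inner_toHom_left, ← toHom_mul_apply, ← hz, inner_toHom_left, hp.1.star_eq,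
      ← toHom_mul_apply, ← toHom_mul_apply, ← mul_assoc, mul_assoc p, hl, map_smul,
      smul_apply, hz, inner_smul_right, inner_self_eq_norm_sq_to_K, hz1] at h1
    simpa using h1.symm
  refine unitarilyEquiv_of_norm_eq (x := x) (y := y) hπ hρ (by rintro rfl; simp at hx1)
    (by rintro rfl; simp at hy1) fun a => ?_
  obtain ⟨l, hl⟩ := hp.2.2.2 (star a * a)
  have h1 := (key π x hx1 hx a l hl).trans (key ρ y hy1 hy a l hl).symm
  have h2 : ‖π.toHom a x‖ ^ 2 = ‖ρ.toHom a y‖ ^ 2 := by exact_mod_cast h1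
  exact (pow_left_inj₀ (norm_nonneg _) (norm_nonneg _) two_ne_zero).1 h2

end CStarRep

/-! ### Fixed states, the GNS construction and extreme points. -/

section FixedStates

open scoped ComplexOrder

variable {A : Type u} [NonUnitalCStarAlgebra A]

/-- The positive functionals of norm at most one on which every `e ∈ s` acts as a unit. -/
def fixedStates (s : Set A) : Set (WeakDual ℂ A) :=
  {φ | (∀ a, ‖φ a‖ ≤ ‖a‖) ∧ (∀ a, 0 ≤ φ (star a * a)) ∧
    ∀ e ∈ s, φ e = 1 ∧ ∀ a, φ (a * e) = φ a ∧ φ (e * a) = φ a}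

theorem isClosed_fixedStates (s : Set A) : IsClosed (fixedStates s) := by
  have hc : ∀ a : A, Continuous fun φ : WeakDual ℂ A => φ a := WeakDual.eval_continuous
  have : fixedStates s = (⋂ a, {φ | ‖φ a‖ ≤ ‖a‖}) ∩ ((⋂ a, {φ | φ (star a * a) ∈ Set.Ici (0 : ℂ)}) ∩
      ⋂ e ∈ s, ({φ | φ e = 1} ∩ ⋂ a, ({φ | φ (a * e) = φ a} ∩ {φ | φ (e * a) = φ a}))) := by
    ext φ
    simp [fixedStates]
  rw [this]
  refine (isClosed_iInter fun a => isClosed_le (hc a).norm continuous_const).inter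
    ((isClosed_iInter fun a => isClosed_Ici.preimage (hc _)).inter
    (isClosed_biInter fun e _ => (isClosed_eq (hc e) continuous_const).inter
    (isClosed_iInter fun a => (isClosed_eq (hc _) (hc _)).inter (isClosed_eq (hc _) (hc _)))))

theorem isCompact_fixedStates (s : Set A) : IsCompact (fixedStates s) := by
  refine (WeakDual.isCompact_closedBall (𝕜 := ℂ) (E := A) 0 1).of_isClosed_subset
    (isClosed_fixedStates s) fun φ hφ => ?_
  rw [Set.mem_preimage, mem_closedBall_zero_iff]
  exact ContinuousLinearMap.opNorm_le_bound _ zero_le_one fun a => by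
    rw [one_mul]; exact hφ.1 a

theorem fixedStates_anti {s t : Set A} (h : s ⊆ t) : fixedStates t ⊆ fixedStates s :=
  fun _ hφ => ⟨hφ.1, hφ.2.1, fun e he => hφ.2.2 e (h he)⟩

namespace CStarRep

/-- The functional `a ↦ ⟪v, π(a)v⟫`. -/
noncomputable def vectorFunctional (π : CStarRep A) (v : π.H) : WeakDual ℂ A :=
  StrongDual.toWeakDual ((innerSL ℂ v).comp ⟨π.orbit v, π.continuous_orbit v⟩)

theorem vectorFunctional_apply (π : CStarRep A) (v : π.H) (a : A) :
    π.vectorFunctional v a = inner ℂ v (π.toHom a v) := rfl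

theorem vectorFunctional_mem_fixedStates (π : CStarRep A) {v : π.H} (hv : ‖v‖ = 1) {s : Set A}
    (hs : ∀ e ∈ s, IsSelfAdjoint e) (h : ∀ e ∈ s, π.toHom e v = v) :
    π.vectorFunctional v ∈ fixedStates s := by
  refine ⟨fun a => ?_, fun a => ?_, fun e he => ⟨?_, fun a => ⟨?_, ?_⟩⟩⟩
  · rw [vectorFunctional_apply]
    refine (norm_inner_le_norm _ _).trans ?_
    rw [hv, one_mul]
    refine ((π.toHom a).le_opNorm v).trans ?_
    rw [hv, mul_one]
    exact π.norm_toHom_le a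
  · rw [vectorFunctional_apply, toHom_mul_apply, inner_toHom_right, star_star,
      inner_self_eq_norm_sq_to_K]
    convert Complex.zero_le_real.2 (sq_nonneg ‖π.toHom a v‖) using 1
    simp
  · rw [vectorFunctional_apply, h e he, inner_self_eq_norm_sq_to_K, hv]
    simp
  · rw [vectorFunctional_apply, toHom_mul_apply, h e he, vectorFunctional_apply]
  · rw [vectorFunctional_apply, toHom_mul_apply, inner_toHom_right, (hs e he).star_eq, h e he,
      vectorFunctional_apply]

end CStarRep

/-- The Gelfand–Naimark–Segal representation of a positive functional. -/
theorem exists_gns_representation (φ : A →ₗ[ℂ] ℂ) (hφ : ∀ a, 0 ≤ φ (star a * a)) :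
    ∃ (π : CStarRep A) (q : A →ₗ[ℂ] π.H), DenseRange q ∧
      (∀ a b, inner ℂ (q a) (q b) = φ (star a * b)) ∧ ∀ a b, π.toHom a (q b) = q (a * b) := by
  let _ : PartialOrder A := CStarAlgebra.spectralOrder A
  have : StarOrderedRing A := CStarAlgebra.spectralOrderedRing A
  let f : A →ₚ[ℂ] ℂ := PositiveLinearMap.mk₀ φ fun x hx => by
    obtain ⟨b, rfl⟩ := CStarAlgebra.nonneg_iff_eq_star_mul_self.1 hx
    exact hφ b
  let π : CStarRep A := ⟨f.GNS, f.gnsNonUnitalStarAlgHom⟩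
  let q : A →ₗ[ℂ] π.H :=
    (UniformSpace.Completion.toComplL (𝕜 := ℂ) (E := f.PreGNS)).toLinearMap ∘ₗ
      f.toPreGNS.toLinearMap
  refine ⟨π, q, ?_, fun a b => ?_, fun a b => ?_⟩
  · exact UniformSpace.Completion.denseRange_coe.comp f.toPreGNS.surjective.denseRange
      (UniformSpace.Completion.continuous_coe _)
  · exact UniformSpace.Completion.inner_coe _ _
  · exact f.gnsNonUnitalStarAlgHom_apply_coe

theorem Submodule.starProjection_toHom_comm (π : CStarRep A) (K : Submodule ℂ π.H)
    [K.HasOrthogonalProjection] (hK : ∀ a, ∀ x ∈ K, π.toHom a x ∈ K) (a : A) (x : π.H) :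
    π.toHom a (K.starProjection x) = K.starProjection (π.toHom a x) := by
  refine (K.eq_starProjection_of_mem_orthogonal (hK a _ (K.starProjection_apply_mem x)) ?_).symm
  rw [← map_sub, Submodule.mem_orthogonal]
  intro k hk
  rw [CStarRep.inner_toHom_right]
  exact (K.mem_orthogonal _).1 (K.sub_starProjection_mem_orthogonal x) _ (hK _ k hk)

/-- A cyclic representation whose vector functional is an extreme point of `fixedStates s` is
irreducible. -/
theorem CStarRep.isIrreducible_of_extremePoint {π : CStarRep A} {s : Set A} (hs0 : s.Nonempty)
    (hs : ∀ e ∈ s, IsSelfAdjoint e) {ξ : π.H} (hξ : ‖ξ‖ = 1) (hfix : ∀ e ∈ s, π.toHom e ξ = ξ)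
    (hcyc : DenseRange (π.orbit ξ))
    (hext : π.vectorFunctional ξ ∈ (fixedStates s).extremePoints ℝ) : π.IsIrreducible := by
  have hξ0 : ξ ≠ 0 := by rintro rfl; simp at hξ
  refine ⟨fun h0 => ?_, fun K hKc hK => ?_⟩
  · obtain ⟨e, he⟩ := hs0
    have := hfix e he
    rw [h0] at this
    exact hξ0 this.symm
  have : CompleteSpace K := hKc.completeSpace_coe
  have hcomm := K.starProjection_toHom_comm π hK
  set u := K.starProjection ξ with hu
  have huK : u ∈ K := K.starProjection_apply_mem ξ
  obtain ⟨w, hw⟩ : ∃ w, w = ξ - u := ⟨_, rfl⟩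
  have hwK : w ∈ Kᗮ := hw ▸ K.sub_starProjection_mem_orthogonal ξ
  have hadd : ξ = u + w := by rw [hw]; abel
  have hfu : ∀ e ∈ s, π.toHom e u = u := fun e he => by rw [hu, hcomm, hfix e he]
  have hfw : ∀ e ∈ s, π.toHom e w = w := fun e he => by rw [hw, map_sub, hfu e he, hfix e he]
  have hmem : ξ ∈ K → K = ⊤ := fun h => by
    rw [eq_top_iff]
    intro x _
    exact hcyc.induction_on x hKc fun a => hK a ξ h
  by_cases hw0 : w = 0
  · exact Or.inr (hmem (by rw [hadd, hw0, add_zero]; exact huK))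
  by_cases hu0 : u = 0
  · left
    rw [Submodule.eq_bot_iff]
    intro x hx
    have h1 : K.starProjection x = 0 := by
      refine hcyc.induction_on (p := fun x => K.starProjection x = 0) x
        (isClosed_eq K.starProjection.continuous continuous_const) fun a => ?_
      rw [CStarRep.orbit_apply, ← hcomm, ← hu, hu0, map_zero]
    rwa [Submodule.starProjection_eq_self_iff.2 hx] at h1
  exfalso
  have hun := norm_pos_iff.2 hu0
  have hwn := norm_pos_iff.2 hw0
  have hsum : ‖u‖ ^ 2 + ‖w‖ ^ 2 = 1 := by
    have h := norm_add_sq_eq_norm_sq_add_norm_sq_of_inner_eq_zero u w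
      ((K.mem_orthogonal _).1 hwK u huK)
    rw [← hadd, hξ] at h
    nlinarith
  have hnorm : ∀ v : π.H, v ≠ 0 → (∀ e ∈ s, π.toHom e v = v) →
      π.vectorFunctional ((‖v‖⁻¹ : ℂ) • v) ∈ fixedStates s ∧
      ∀ a, ((‖v‖ ^ 2 : ℝ) : ℂ) * π.vectorFunctional ((‖v‖⁻¹ : ℂ) • v) a =
        inner ℂ v (π.toHom a v) := by
    refine fun v hv hfv => ⟨π.vectorFunctional_mem_fixedStates (norm_smul_inv_norm hv) hs
      fun e he => by rw [map_smul, hfv e he], fun a => ?_⟩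
    have : (‖v‖ : ℂ) ≠ 0 := by simpa using hv
    rw [CStarRep.vectorFunctional_apply, map_smul, inner_smul_left, inner_smul_right]
    simp only [map_inv₀, Complex.conj_ofReal, Complex.ofReal_pow]
    field_simp
  obtain ⟨hu1, hu2⟩ := hnorm u hu0 hfu
  obtain ⟨hw1, hw2⟩ := hnorm w hw0 hfw
  -- The cross terms vanish because `K` and its complement are invariant, so a proper nonzero `K`
  -- splits the functional with weights `‖u‖²` and `‖w‖²`.
  have hseg : π.vectorFunctional ξ ∈ openSegment ℝ (π.vectorFunctional ((‖u‖⁻¹ : ℂ) • u))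
      (π.vectorFunctional ((‖w‖⁻¹ : ℂ) • w)) := by
    refine ⟨‖u‖ ^ 2, ‖w‖ ^ 2, by positivity, by positivity, hsum, ?_⟩
    refine DFunLike.ext _ _ fun a => ?_
    change ((‖u‖ ^ 2 : ℝ)) • π.vectorFunctional ((‖u‖⁻¹ : ℂ) • u) a +
      ((‖w‖ ^ 2 : ℝ)) • π.vectorFunctional ((‖w‖⁻¹ : ℂ) • w) a = _
    rw [Complex.real_smul, Complex.real_smul, hu2, hw2, CStarRep.vectorFunctional_apply]
    conv_rhs => rw [hadd]
    rw [map_add, inner_add_left, inner_add_right, inner_add_right,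
      (K.mem_orthogonal' _).1 hwK _ (hK a u huK), π.inner_toHom_right a u w,
      (K.mem_orthogonal _).1 hwK _ (hK _ u huK)]
    ring
  have heq := (mem_extremePoints.1 hext).2 _ hu1 _ hw1 hseg |>.1
  -- Extremality equates the functional of `ξ` with that of normalised `u`; by cyclicity `u` is then
  -- a multiple of `ξ`, forcing `ξ ∈ K` and `w = 0`.
  have hperp : ∀ x, inner ℂ (u - ((‖u‖ ^ 2 : ℝ) : ℂ) • ξ) x = 0 := by
    intro x
    refine hcyc.induction_on (p := fun x => inner ℂ (u - ((‖u‖ ^ 2 : ℝ) : ℂ) • ξ) x = 0) x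
      (isClosed_eq (by fun_prop) continuous_const) fun a => ?_
    have h1 : inner ℂ u (π.toHom a ξ) = inner ℂ u (π.toHom a u) := by
      rw [hadd, map_add, inner_add_right, π.inner_toHom_right a u w,
        (K.mem_orthogonal _).1 hwK _ (hK _ u huK), add_zero]
    rw [CStarRep.orbit_apply, inner_sub_left, inner_smul_left, h1, ← hu2, heq,
      CStarRep.vectorFunctional_apply, Complex.conj_ofReal, sub_self]
  have hut : u = ((‖u‖ ^ 2 : ℝ) : ℂ) • ξ := sub_eq_zero.1 (inner_self_eq_zero.1 (hperp _))
  have hξK : ξ ∈ K := by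
    have h2 : ((‖u‖ ^ 2 : ℝ) : ℂ) ≠ 0 := by simpa using hu0
    rw [← Submodule.smul_mem_iff K h2, ← hut]
    exact huK
  rw [hu, Submodule.starProjection_eq_self_iff.2 hξK, sub_self] at hw
  exact hw0 hw

/-- If `fixedStates s` is nonempty, some irreducible representation has a unit vector fixed by
every element of `s`. -/
theorem exists_isIrreducible_fixed_vector {s : Set A} (hs0 : s.Nonempty)
    (hs : ∀ e ∈ s, IsSelfAdjoint e) (h : (fixedStates s).Nonempty) :
    ∃ π : CStarRep A, π.IsIrreducible ∧ ∃ ξ : π.H, ‖ξ‖ = 1 ∧ ∀ e ∈ s, π.toHom e ξ = ξ := by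
  have : LocallyConvexSpace ℝ (WeakDual ℂ A) :=
    WeakBilin.locallyConvexSpace (B := topDualPairing ℂ A)
  obtain ⟨φ, hφ⟩ := (isCompact_fixedStates s).extremePoints_nonempty h
  obtain ⟨-, hpos, hfix⟩ := hφ.1
  obtain ⟨π, q, hq, hin, hmul⟩ := exists_gns_representation
    (WeakDual.toStrongDual φ).toLinearMap hpos
  have hin : ∀ a b, inner ℂ (q a) (q b) = φ (star a * b) := hin
  obtain ⟨e₀, he₀⟩ := hs0
  have hqe : ∀ a, ∀ e ∈ s, q (a * e) = q a := fun a e he => by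
    rw [← sub_eq_zero, ← map_sub, ← inner_self_eq_zero (𝕜 := ℂ), hin, mul_sub, map_sub,
      ← mul_assoc, ((hfix e he).2 _).1, sub_self]
  -- All elements of `s` have the same GNS image, which serves as the cyclic vector that the class
  -- of a unit would give.
  have hqs : ∀ e ∈ s, q e = q e₀ := fun e he => by
    rw [← sub_eq_zero, ← map_sub, ← inner_self_eq_zero (𝕜 := ℂ), hin, mul_sub, map_sub,
      ((hfix e he).2 _).1, ((hfix e₀ he₀).2 _).1, sub_self]
  have horb : ∀ a, π.toHom a (q e₀) = q a := fun a => by rw [hmul, hqe a e₀ he₀]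
  have hξ : ‖q e₀‖ = 1 := by
    have h1 := inner_self_eq_norm_sq_to_K (𝕜 := ℂ) (q e₀)
    rw [hin, ((hfix e₀ he₀).2 _).1, (hs e₀ he₀).star_eq, (hfix e₀ he₀).1] at h1
    have h2 : (1 : ℝ) = ‖q e₀‖ ^ 2 :=
      Complex.ofReal_injective (by rw [Complex.ofReal_one, h1]; simp)
    nlinarith [norm_nonneg (q e₀)]
  have hf : ∀ e ∈ s, π.toHom e (q e₀) = q e₀ := fun e he => by rw [horb, hqs e he]
  have hvec : π.vectorFunctional (q e₀) = φ := DFunLike.ext _ _ fun a => by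
    rw [CStarRep.vectorFunctional_apply, horb, hin, (hs e₀ he₀).star_eq, ((hfix e₀ he₀).2 _).2]
  refine ⟨π, CStarRep.isIrreducible_of_extremePoint ⟨e₀, he₀⟩ hs hξ hf ?_ (hvec ▸ hφ), q e₀, hξ, hf⟩
  have : ⇑(π.orbit (q e₀)) = q := funext horb
  rw [this]
  exact hq

end FixedStates

/-! ### Diagonal construction of a new faithful irreducible representation. -/

section Construction

variable {A : Type u} [NonUnitalCStarAlgebra A]

/-- A countable family of requirements, each of which can be met below every nonzero selfadjoint
element, can be met along one decreasing sequence of local units. -/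
theorem exists_seq_localUnit {ι : Type*} [Countable ι] [Nonempty ι] (R : ι → A → Prop)
    (hR : ∀ i b, IsSelfAdjoint b → b ≠ 0 →
      ∃ c d, IsSelfAdjoint c ∧ c ≠ 0 ∧ c = b * d ∧ R i c)
    {b₀ : A} (hb₀ : IsSelfAdjoint b₀) (hb₀' : b₀ ≠ 0) :
    ∃ e b : ℕ → A, (∀ n, IsSelfAdjoint (e n)) ∧ (∀ n, b n ≠ 0) ∧
      (∀ k n, k < n → e k * b n = b n) ∧ ∀ i, ∃ n c d, R i c ∧ e n = c * d := by
  obtain ⟨f, hf⟩ := exists_surjective_nat ι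
  have step : ∀ (n : ℕ) (b : {b : A // IsSelfAdjoint b ∧ b ≠ 0}),
      ∃ (e : A) (b' : {b : A // IsSelfAdjoint b ∧ b ≠ 0}), IsSelfAdjoint e ∧ e * b'.1 = b'.1 ∧
        (∃ g, b'.1 = b.1 * g) ∧ ∃ c d, R (f n) c ∧ e = c * d := by
    rintro n ⟨b, hb, hb0⟩
    obtain ⟨c, d, hc, hc0, hcd, hcR⟩ := hR (f n) b hb hb0
    obtain ⟨e, b', d', g, he, hb', hb0', heb, hed, hbg⟩ := hc.exists_local_unit hc0
    exact ⟨e, ⟨b', hb', hb0'⟩, he, heb, ⟨d * g, by rw [← mul_assoc, ← hcd]; exact hbg⟩, c, d', hcR, hed⟩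
  choose E B hE hEB hB hRc using step
  let b : ℕ → {b : A // IsSelfAdjoint b ∧ b ≠ 0} := fun n => Nat.rec ⟨b₀, hb₀, hb₀'⟩ B n
  refine ⟨fun n => E n (b n), fun n => (b n).1, fun n => hE _ _, fun n => (b n).2.2,
    fun k n hkn => ?_, fun i => ?_⟩
  · induction n, hkn using Nat.le_induction with
    | base => exact hEB k (b k)
    | succ n _ ih =>
      obtain ⟨g, hg⟩ := hB n (b n)
      have : (b (n + 1)).1 = (b n).1 * g := hg
      change E k (b k) * (b (n + 1)).1 = (b (n + 1)).1
      rw [this, ← mul_assoc, ih]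
  · obtain ⟨n, rfl⟩ := hf i
    exact ⟨n, hRc n (b n)⟩

/-- Splitting halves the weight of a vector `η` on the range of `π(b)`. -/
theorem SplitsBelow.exists_half_weight {b : A} (hb : SplitsBelow b) (π : CStarRep A) (η : π.H)
    {C : ℝ} (hC : ∀ u, ‖inner ℂ (π.toHom b u) η‖ ^ 2 ≤ C * ‖π.toHom b u‖ ^ 2) :
    ∃ c d, IsSelfAdjoint c ∧ c ≠ 0 ∧ c = b * d ∧
      ∀ u, ‖inner ℂ (π.toHom c u) η‖ ^ 2 ≤ C / 2 * ‖π.toHom c u‖ ^ 2 := by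
  obtain ⟨c₁, c₂, d₁, d₂, h1, h2, h3, h4, h5, h6, h7⟩ := hb
  by_contra! hcon
  obtain ⟨u₁, hu₁⟩ := hcon c₁ (d₁ * b) h1 h3 (by rw [h6, mul_assoc])
  obtain ⟨u₂, hu₂⟩ := hcon c₂ (d₂ * b) h2 h4 (by rw [h7, mul_assoc])
  have hperp : inner ℂ (π.toHom c₁ u₁) (π.toHom c₂ u₂) = 0 := by
    rw [CStarRep.inner_toHom_left, h1.star_eq, ← CStarRep.toHom_mul_apply, h5]
    simp
  have hbv₁ : π.toHom c₁ u₁ = π.toHom b (π.toHom (d₁ * b) u₁) := by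
    rw [← CStarRep.toHom_mul_apply, h6, mul_assoc]
  have hbv₂ : π.toHom c₂ u₂ = π.toHom b (π.toHom (d₂ * b) u₂) := by
    rw [← CStarRep.toHom_mul_apply, h7, mul_assoc]
  set v₁ := π.toHom c₁ u₁
  set v₂ := π.toHom c₂ u₂
  have hv₁ : 0 < ‖v₁‖ := norm_pos_iff.2 (by rintro h; simp [h] at hu₁)
  have hv₂ : 0 < ‖v₂‖ := norm_pos_iff.2 (by rintro h; simp [h] at hu₂)
  set α := inner ℂ v₁ η
  set β := inner ℂ v₂ η
  have key : ∀ s t : ℂ, ‖star s * α + star t * β‖ ^ 2 ≤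
      C * (‖s‖ ^ 2 * ‖v₁‖ ^ 2 + ‖t‖ ^ 2 * ‖v₂‖ ^ 2) := by
    intro s t
    have h := hC (s • π.toHom (d₁ * b) u₁ + t • π.toHom (d₂ * b) u₂)
    rw [map_add, map_smul, map_smul, ← hbv₁, ← hbv₂, inner_add_left, inner_smul_left,
      inner_smul_left] at h
    have hn := norm_add_sq_eq_norm_sq_add_norm_sq_of_inner_eq_zero (s • v₁) (t • v₂)
      (by rw [inner_smul_left, inner_smul_right, hperp]; simp)
    rw [norm_smul, norm_smul] at hn
    calc _ ≤ _ := h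
      _ = _ := by
        congr 1
        nlinarith
  obtain ⟨x, hx⟩ : ∃ x : ℝ, x = ‖α‖ ^ 2 / ‖v₁‖ ^ 2 := ⟨_, rfl⟩
  obtain ⟨y, hy⟩ : ∃ y : ℝ, y = ‖β‖ ^ 2 / ‖v₂‖ ^ 2 := ⟨_, rfl⟩
  have hx' : C / 2 < x := by rw [hx, lt_div_iff₀ (by positivity)]; exact hu₁
  have hy' : C / 2 < y := by rw [hy, lt_div_iff₀ (by positivity)]; exact hu₂
  have hx0 : 0 ≤ x := by rw [hx]; positivity
  have hy0 : 0 ≤ y := by rw [hy]; positivity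
  -- These are the coefficients of the projection of `η` onto the span of `v₁` and `v₂`. They give
  -- `(x + y)² ≤ C (x + y)`, while both `x` and `y` exceed `C / 2`.
  have h := key (α / (‖v₁‖ ^ 2 : ℝ)) (β / (‖v₂‖ ^ 2 : ℝ))
  have e1 : star (α / (‖v₁‖ ^ 2 : ℝ)) * α + star (β / (‖v₂‖ ^ 2 : ℝ)) * β = ((x + y : ℝ) : ℂ) := by
    simp only [Complex.star_def, map_div₀, Complex.conj_ofReal, div_mul_eq_mul_div,
      Complex.conj_mul', hx, hy]
    push_cast
    ring
  have e2 : ∀ (γ : ℂ) (r : ℝ), 0 < r → ‖γ / (r ^ 2 : ℝ)‖ ^ 2 * r ^ 2 = ‖γ‖ ^ 2 / r ^ 2 := by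
    intro γ r hr
    rw [norm_div, Complex.norm_real, Real.norm_of_nonneg (by positivity)]
    field_simp
  rw [e1, e2 _ _ hv₁, e2 _ _ hv₂, ← hx, ← hy, Complex.norm_real,
    Real.norm_of_nonneg (by positivity)] at h
  have hC0 : 0 ≤ C := by
    by_contra! hneg
    have h1 := key 1 0
    simp only [norm_one, norm_zero] at h1
    nlinarith [mul_pos (neg_pos.2 hneg) (pow_pos hv₁ 2),
      sq_nonneg ‖star (1 : ℂ) * α + star (0 : ℂ) * β‖]
  have hpos : 0 < x + y := by linarith
  have hle : x + y ≤ C := le_of_mul_le_mul_right (by rwa [← sq]) hpos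
  linarith

/-- Cauchy–Schwarz gives the initial weight `‖η‖²`, and repeated halving brings it below `1 / 4`.
Any constant below `1` in the conclusion would serve the later contradiction with a unit vector. -/
theorem exists_small_weight (hD : ∀ x : A, IsSelfAdjoint x → x ≠ 0 → SplitsBelow x)
    (π : CStarRep A) (η : π.H) {b : A} (hb : IsSelfAdjoint b) (hb0 : b ≠ 0) :
    ∃ c d, IsSelfAdjoint c ∧ c ≠ 0 ∧ c = b * d ∧
      ∀ u, ‖inner ℂ (π.toHom c u) η‖ ≤ 1 / 2 * ‖π.toHom c u‖ := by
  have key : ∀ N : ℕ, ∃ c d, IsSelfAdjoint c ∧ c ≠ 0 ∧ c = b * d ∧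
      ∀ u, ‖inner ℂ (π.toHom c u) η‖ ^ 2 ≤ ‖η‖ ^ 2 / 2 ^ (N + 1) * ‖π.toHom c u‖ ^ 2 := by
    intro N
    induction N with
    | zero =>
      simpa using (hD b hb hb0).exists_half_weight π η (C := ‖η‖ ^ 2) fun u => by
        rw [← mul_pow, mul_comm]
        gcongr
        exact norm_inner_le_norm _ _
    | succ N ih =>
      obtain ⟨c, d, hc, hc0, hcd, hw⟩ := ih
      obtain ⟨c', d', hc', hc0', hcd', hw'⟩ := (hD c hc hc0).exists_half_weight π η hw
      refine ⟨c', d * d', hc', hc0', by rw [← mul_assoc, ← hcd, hcd'], fun u => ?_⟩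
      rw [pow_succ (2 : ℝ) (N + 1), ← div_div]
      exact hw' u
  obtain ⟨N, hN⟩ := pow_unbounded_of_one_lt (4 * ‖η‖ ^ 2) (one_lt_two (α := ℝ))
  obtain ⟨c, d, hc, hc0, hcd, hw⟩ := key N
  refine ⟨c, d, hc, hc0, hcd, fun u => ?_⟩
  refine (pow_le_pow_iff_left₀ (norm_nonneg _) (by positivity) two_ne_zero).1 ((hw u).trans ?_)
  rw [mul_pow]
  gcongr
  rw [div_le_iff₀ (by positivity), pow_succ (2 : ℝ) N]
  linarith [pow_pos (two_pos (α := ℝ)) N]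

/-- A primitive C⋆-algebra is prime. -/
theorem CStarRep.IsIrreducible.exists_mul_mul_ne_zero {π : CStarRep A} (hi : π.IsIrreducible)
    (hf : π.IsFaithful) {a b : A} (ha : a ≠ 0) (hb : b ≠ 0) : ∃ x, a * x * b ≠ 0 := by
  by_contra! h
  obtain ⟨y, hy⟩ := exists_toHom_apply_ne_zero (hf.toHom_ne_zero hb)
  refine hf.toHom_ne_zero ha (ContinuousLinearMap.ext fun z => ?_)
  refine (hi.denseRange_orbit hy).induction_on (p := fun z => π.toHom a z = 0) z
    (isClosed_eq (π.toHom a).continuous continuous_const) fun x => ?_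
  rw [orbit_apply, ← toHom_mul_apply, ← toHom_mul_apply, h]
  simp

/-- A normalised vector in the range of `π(b n)` is fixed by every `e k` with `k < n`; compactness
passes to all `k` at once. -/
theorem fixedStates_range_nonempty {π : CStarRep A} (hf : π.IsFaithful) {e b : ℕ → A}
    (he : ∀ n, IsSelfAdjoint (e n)) (hb : ∀ n, b n ≠ 0)
    (heb : ∀ k n, k < n → e k * b n = b n) : (fixedStates (Set.range e)).Nonempty := by
  have h : (⋂ n, fixedStates (e '' Set.Iio n)).Nonempty := by
    refine IsCompact.nonempty_iInter_of_sequence_nonempty_isCompact_isClosed _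
      (fun n => fixedStates_anti (Set.image_mono (Set.Iio_subset_Iio n.le_succ))) (fun n => ?_)
      (isCompact_fixedStates _) (fun n => isClosed_fixedStates _)
    obtain ⟨y, hy⟩ := CStarRep.exists_toHom_apply_ne_zero (hf.toHom_ne_zero (hb n))
    refine ⟨_, π.vectorFunctional_mem_fixedStates (norm_smul_inv_norm (𝕜 := ℂ) hy) ?_ ?_⟩
    · rintro _ ⟨k, -, rfl⟩
      exact he k
    · rintro _ ⟨k, hk, rfl⟩
      rw [map_smul, ← CStarRep.toHom_mul_apply, heb k n hk]
  obtain ⟨φ, hφ⟩ := h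
  rw [Set.mem_iInter] at hφ
  refine ⟨φ, (hφ 0).1, (hφ 0).2.1, ?_⟩
  rintro _ ⟨k, rfl⟩
  exact (hφ (k + 1)).2.2 _ ⟨k, Nat.lt_succ_self k, rfl⟩

open TopologicalSpace in
/-- In a separable primitive C⋆-algebra without minimal projections, no countable family of
irreducible representations exhausts the faithful ones up to equivalence. -/
theorem exists_faithful_not_unitarilyEquiv [SeparableSpace A] {π : CStarRep A}
    (hi : π.IsIrreducible) (hf : π.IsFaithful) (hD : ∀ p : A, ¬ IsMinimalProjection p)
    (σ : ℕ → CStarRep A) (hσ : ∀ n, (σ n).IsIrreducible) :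
    ∃ ρ : CStarRep A, ρ.IsIrreducible ∧ ρ.IsFaithful ∧ ∀ n, ¬ ρ.UnitarilyEquiv (σ n) := by
  have hsplit : ∀ x : A, IsSelfAdjoint x → x ≠ 0 → SplitsBelow x := fun x hx hx0 =>
    (hx.splitsBelow_or_exists_isMinimalProjection hx0).resolve_right (by simpa using hD)
  obtain ⟨a, ha⟩ : ∃ a : A, a ≠ 0 := by
    by_contra! h
    exact hi.1 (NonUnitalStarAlgHom.ext fun a => by rw [h a]; simp)
  have ha' := (CStarRing.star_mul_self_ne_zero_iff a).2 ha
  -- A nonzero kernel contains the first entry of some pair in `S`. A pair `(e, b)` close to it has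
  -- `‖ρ(e)‖ < 1`, and `e * b = b` then forces `ρ(b) = 0`; so testing a dense sequence of pairs
  -- suffices for faithfulness.
  let S : Set (A × A) := {p | p.1 * p.2 = p.2 ∧ p.2 ≠ 0}
  have : Nonempty S := by
    obtain ⟨e, b, -, -, -, -, hb0, heb, -⟩ := (IsSelfAdjoint.star_mul_self a).exists_local_unit ha'
    exact ⟨⟨(e, b), heb, hb0⟩⟩
  have : SecondCountableTopology A := UniformSpace.secondCountable_of_separable A
  have hsep : ∀ n, SeparableSpace (σ n).H := fun n => by
    obtain ⟨a, ha⟩ : ∃ a, (σ n).toHom a ≠ 0 := by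
      by_contra! h
      exact (hσ n).1 (NonUnitalStarAlgHom.ext h)
    obtain ⟨y, hy⟩ := CStarRep.exists_toHom_apply_ne_zero ha
    have hy0 : y ≠ 0 := by rintro rfl; simp at hy
    exact ((hσ n).denseRange_orbit hy0).separableSpace ((σ n).continuous_orbit y)
  let R : (ℕ × ℕ) ⊕ ℕ → A → Prop := Sum.elim
    (fun q c => ∀ u, ‖inner ℂ ((σ q.1).toHom c u) (denseSeq (σ q.1).H q.2)‖ ≤
      1 / 2 * ‖(σ q.1).toHom c u‖)
    (fun j c => ∃ x y, c = x * (denseSeq S j).1.2 * y)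
  have hR : ∀ i b, IsSelfAdjoint b → b ≠ 0 →
      ∃ c d, IsSelfAdjoint c ∧ c ≠ 0 ∧ c = b * d ∧ R i c := by
    rintro (q | j) b hb hb0
    · exact exists_small_weight hsplit (σ q.1) _ hb hb0
    · obtain ⟨x, hx⟩ := hi.exists_mul_mul_ne_zero hf hb0 (denseSeq S j).2.2
      -- Primeness makes `z` nonzero; `z * star z` lies below `b` and in the ideal generated by the
      -- `j`-th test element.
      set z := b * x * (denseSeq S j).1.2 with hz
      exact ⟨z * star z, x * (denseSeq S j).1.2 * star z, IsSelfAdjoint.mul_star_self z,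
        (CStarRing.mul_star_self_ne_zero_iff z).2 hx, by simp only [hz, mul_assoc], b * x, star z, rfl⟩
  obtain ⟨e, b, he, hb, heb, hRe⟩ :=
    exists_seq_localUnit R hR (IsSelfAdjoint.star_mul_self a) ha'
  obtain ⟨ρ, hρ, ξ, hξ, hfix⟩ := exists_isIrreducible_fixed_vector (Set.range_nonempty e)
    (by rintro _ ⟨n, rfl⟩; exact he n) (fixedStates_range_nonempty hf he hb heb)
  have hfix : ∀ n, ρ.toHom (e n) ξ = ξ := fun n => hfix _ ⟨n, rfl⟩
  have hξ0 : ξ ≠ 0 := by rintro rfl; simp at hξ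
  refine ⟨ρ, hρ, ?_, ?_⟩
  · refine (injective_iff_map_eq_zero ρ.toHom).2 fun x hx => ?_
    by_contra hx0
    obtain ⟨e', b', d, -, -, -, hb0', heb', hed, -⟩ :=
      (IsSelfAdjoint.star_mul_self x).exists_local_unit
        ((CStarRing.star_mul_self_ne_zero_iff x).2 hx0)
    have he0 : ρ.toHom e' = 0 := by rw [hed, map_mul, map_mul, hx]; simp
    obtain ⟨j, hj⟩ := (denseRange_denseSeq S).exists_dist_lt ⟨(e', b'), heb', hb0'⟩ one_pos
    have hj : ‖e' - (denseSeq S j).1.1‖ < 1 := by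
      rw [← dist_eq_norm]
      exact (le_max_left _ _).trans_lt hj
    have hlt : ‖ρ.toHom (denseSeq S j).1.1‖ < 1 := by
      have h1 := ρ.norm_toHom_le (e' - (denseSeq S j).1.1)
      rw [map_sub, he0, zero_sub, norm_neg] at h1
      exact h1.trans_lt hj
    have hzero : ρ.toHom (denseSeq S j).1.2 = 0 := by
      have h2 : ‖ρ.toHom (denseSeq S j).1.2‖ ≤
          ‖ρ.toHom (denseSeq S j).1.1‖ * ‖ρ.toHom (denseSeq S j).1.2‖ := by
        conv_lhs => rw [← (denseSeq S j).2.1, map_mul]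
        exact norm_mul_le _ _
      rw [← norm_eq_zero]
      nlinarith [norm_nonneg (ρ.toHom (denseSeq S j).1.2)]
    obtain ⟨n, c, d, ⟨x, y, hc⟩, hcd⟩ := hRe (Sum.inr j)
    refine hξ0 ?_
    rw [← hfix n, hcd, hc, map_mul, map_mul, map_mul, hzero]
    simp
  · rintro n ⟨U, hU⟩
    -- As `e m = c * d` fixes `ξ`, the vector `U ξ` is in the range of `σ n` at `c`, so the weight
    -- bound applies against a dense set of `w`. Taking `w = U ξ` contradicts `‖U ξ‖ = 1`.
    have hsmall : ∀ w, ‖inner ℂ (U ξ) w‖ ≤ 1 / 2 := by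
      intro w
      refine (denseRange_denseSeq (σ n).H).induction_on
        (p := fun w => ‖inner ℂ (U ξ) w‖ ≤ 1 / 2) w
        (isClosed_le (by fun_prop) continuous_const) fun j => ?_
      obtain ⟨m, c, d, hc, hcd⟩ := hRe (Sum.inl (n, j))
      have hUc : U ξ = (σ n).toHom c ((σ n).toHom d (U ξ)) := by
        rw [← CStarRep.toHom_mul_apply, ← hcd, ← hU, hfix]
      have := hc ((σ n).toHom d (U ξ))
      rwa [← hUc, U.norm_map, hξ, mul_one] at this
    have := hsmall (U ξ)
    rw [inner_self_eq_norm_sq_to_K, U.norm_map, hξ] at this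
    norm_num at this

end Construction

/-! ### Restriction to ideals and antiliminarity. -/

namespace CStarRep

variable {A : Type u} [NonUnitalCStarAlgebra A]

/-- The restriction of a representation to a closed two-sided ideal. -/
noncomputable def restrictIdeal (π : CStarRep A) (I : ClosedTwoSidedIdeal A) :
    CStarRep I.toStarSubalgebra :=
  ⟨π.H, π.toHom.comp (NonUnitalStarSubalgebraClass.subtype I.toStarSubalgebra)⟩

/-- A nonzero closed two-sided ideal acts irreducibly in an irreducible representation that does
not vanish on it. -/
theorem IsIrreducible.eq_bot_or_eq_top_of_ideal_invariant {π : CStarRep A} (hi : π.IsIrreducible)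
    {I : ClosedTwoSidedIdeal A} {b : A} (hb : b ∈ I.carrier) (hb0 : π.toHom b ≠ 0)
    (K : Submodule ℂ π.H) (hKc : IsClosed (K : Set π.H))
    (hK : ∀ c ∈ I.carrier, ∀ x ∈ K, π.toHom c x ∈ K) : K = ⊥ ∨ K = ⊤ := by
  rw [or_iff_not_imp_left]
  intro hbot
  obtain ⟨x, hxK, hx0⟩ := K.exists_mem_ne_zero_of_ne_bot hbot
  obtain ⟨c, hc, hcx⟩ : ∃ c ∈ I.carrier, π.toHom c x ≠ 0 := by
    by_contra! hzero
    refine hb0 (ContinuousLinearMap.ext fun z => ?_)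
    refine (hi.denseRange_orbit hx0).induction_on (p := fun z => π.toHom b z = 0) z
      (isClosed_eq (π.toHom b).continuous continuous_const) fun a => ?_
    rw [orbit_apply, ← toHom_mul_apply]
    exact hzero _ (I.mul_mem_right a hb)
  rw [eq_top_iff]
  intro z _
  refine (hi.denseRange_orbit hcx).induction_on (p := fun z => z ∈ K) z hKc fun a => ?_
  rw [orbit_apply, ← toHom_mul_apply]
  exact hK _ (I.mul_mem_left a hc) x hxK

theorem IsIrreducible.restrictIdeal {π : CStarRep A} (hi : π.IsIrreducible)
    {I : ClosedTwoSidedIdeal A} {b : A} (hb : b ∈ I.carrier) (hb0 : π.toHom b ≠ 0) :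
    (π.restrictIdeal I).IsIrreducible :=
  ⟨fun h => hb0 (DFunLike.congr_fun h (⟨b, hb⟩ : I.toStarSubalgebra)), fun K hKc hK =>
    hi.eq_bot_or_eq_top_of_ideal_invariant hb hb0 K hKc fun c hc => hK ⟨c, hc⟩⟩

/-- The restriction of `π` to an ideal on which it is nonzero stays irreducible, so a nonzero
liminary ideal would put nonzero compact operators in the range of `π`. -/
theorem IsEssential.isAntiliminary {π : CStarRep A} (he : π.IsEssential) (hi : π.IsIrreducible)
    (hf : π.IsFaithful) : IsAntiliminary A := by
  intro I hI
  rw [Submodule.eq_bot_iff]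
  intro b hb
  by_contra hb0
  have hb1 := hf.toHom_ne_zero hb0
  exact hb1 (he _ ⟨b, rfl⟩ (hI _ (hi.restrictIdeal hb hb1) ⟨b, hb⟩))

end CStarRep

/-! ### Counting the faithful classes, and the equivalences. -/

section Dual

variable {A : Type u} [NonUnitalCStarAlgebra A]

theorem faithfulDual_subsingleton {p : A} (hp : IsMinimalProjection p) :
    (faithfulDual A).Subsingleton := by
  rintro _ ⟨π, hπ, rfl⟩ _ ⟨ρ, hρ, rfl⟩
  exact Quotient.sound (CStarRep.unitarilyEquiv_of_isMinimalProjection hp π.2 hπ ρ.2 hρ)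

theorem not_countable_faithfulDual [TopologicalSpace.SeparableSpace A] {π : CStarRep A}
    (hi : π.IsIrreducible) (hf : π.IsFaithful) (he : π.IsEssential) :
    ¬ (faithfulDual A).Countable := by
  intro hc
  have hne : (faithfulDual A).Nonempty := ⟨_, ⟨π, hi⟩, hf, rfl⟩
  obtain ⟨f, hfr⟩ := hc.exists_eq_range hne
  have hout : ∀ n, ∃ σ : {π : CStarRep A // π.IsIrreducible},
      Quotient.mk (irreducibleRepSetoid A) σ = f n := fun n => Quotient.exists_rep (f n)
  choose σ hσ using hout
  obtain ⟨ρ, hρ, hρf, hnot⟩ := exists_faithful_not_unitarilyEquiv hi hf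
    (he.not_isMinimalProjection hi hf) (fun n => (σ n).1) fun n => (σ n).2
  have hmem : Quotient.mk (irreducibleRepSetoid A) ⟨ρ, hρ⟩ ∈ faithfulDual A := ⟨⟨ρ, hρ⟩, hρf, rfl⟩
  rw [hfr] at hmem
  obtain ⟨n, hn⟩ := hmem
  exact hnot n (Quotient.exact (hn.symm.trans (hσ n).symm))

end Dual

theorem proposition2 (A : Type u) [NonUnitalCStarAlgebra A] [TopologicalSpace.SeparableSpace A]
    (hA : IsPrimitiveCStar A) :
    List.TFAE
      [1 < Cardinal.mk (faithfulDual A),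
        ∀ π : CStarRep A, π.IsIrreducible → π.IsFaithful → π.IsEssential,
        ∃ π : CStarRep A, π.IsIrreducible ∧ π.IsFaithful ∧ π.IsEssential,
        ¬ (faithfulDual A).Countable] ∧
    ((1 < Cardinal.mk (faithfulDual A) ∨
        (∀ π : CStarRep A, π.IsIrreducible → π.IsFaithful → π.IsEssential) ∨
        (∃ π : CStarRep A, π.IsIrreducible ∧ π.IsFaithful ∧ π.IsEssential) ∨
        ¬ (faithfulDual A).Countable) →
      IsAntiliminary A) := by
  have h12 : 1 < Cardinal.mk (faithfulDual A) →
      ∀ π : CStarRep A, π.IsIrreducible → π.IsFaithful → π.IsEssential := by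
    rintro h π - hf _ ⟨a, rfl⟩ hc
    by_contra h0
    obtain ⟨p, hp⟩ := CStarRep.exists_isMinimalProjection_of_isCompactOperator hf
      (fun ha => h0 (by rw [ha, map_zero])) hc
    have := (faithfulDual_subsingleton hp).coe_sort
    exact (Cardinal.le_one_iff_subsingleton.2 this).not_gt h
  have h23 : (∀ π : CStarRep A, π.IsIrreducible → π.IsFaithful → π.IsEssential) →
      ∃ π : CStarRep A, π.IsIrreducible ∧ π.IsFaithful ∧ π.IsEssential := by
    intro h
    obtain ⟨π, hi, hf⟩ := hA
    exact ⟨π, hi, hf, h π hi hf⟩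
  have h34 : (∃ π : CStarRep A, π.IsIrreducible ∧ π.IsFaithful ∧ π.IsEssential) →
      ¬ (faithfulDual A).Countable := by
    rintro ⟨π, hi, hf, he⟩
    exact not_countable_faithfulDual hi hf he
  have h41 : ¬ (faithfulDual A).Countable → 1 < Cardinal.mk (faithfulDual A) := by
    intro h
    by_contra! hle
    have := Cardinal.le_one_iff_subsingleton.1 hle
    exact h (Set.subsingleton_coe _ |>.1 this).countable
  have h3 : (∃ π : CStarRep A, π.IsIrreducible ∧ π.IsFaithful ∧ π.IsEssential) →
      IsAntiliminary A := by
    rintro ⟨π, hi, hf, he⟩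
    exact he.isAntiliminary hi hf
  refine ⟨?_, ?_⟩
  · tfae_have 1 → 2 := h12
    tfae_have 2 → 3 := h23
    tfae_have 3 → 4 := h34
    tfae_have 4 → 1 := h41
    tfae_finish
  · rintro (h | h | h | h)
    · exact h3 (h23 (h12 h))
    · exact h3 (h23 h)
    · exact h3 h
    · exact h3 (h23 (h12 (h41 h)))
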